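/- Let $G=(V,E)$ be a finite simple undirected graph with $n$ vertices, and let $a(G)$ denote the maximum size of a set $S\subseteq V$ such that the induced subgraph $G[S]$ is a forest. If $G$ is triangle-free and its average degree $\frac1n\sum_{v\in V} d(v)$ is at most $4$, then $$a(G)\;\ge\;\frac{15n}{29}.$$ -/

import Mathlib

namespace InducedForest

variable {V : Type*}

/-- A set `S` of vertices is acyclic in `G` if the induced subgraph `G[S]` is a forest. -/
def IsAcyclicSet (G : SimpleGraph V) (S : Finset V) : Prop :=
  (G.induce (S : Set V)).IsAcyclic

/-- `a(G)`: the maximum size of an acyclic set of vertices of a finite graph `G`. -/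
noncomputable def forestNumber [Fintype V] (G : SimpleGraph V) : ℕ :=
  sSup {k : ℕ | ∃ S : Finset V, IsAcyclicSet G S ∧ S.card = k}

/-- The average degree of a finite graph. -/
def averageDegree [Fintype V] (G : SimpleGraph V) [DecidableRel G.Adj] : ℚ :=
  (∑ v : V, (G.degree v : ℚ)) / (Fintype.card V : ℚ)

/-- The supremum defining `a(G)` is an attained maximum. -/
theorem forestNumber_isGreatest [Fintype V] (G : SimpleGraph V) :
    IsGreatest {k : ℕ | ∃ S : Finset V, IsAcyclicSet G S ∧ S.card = k} (forestNumber G) := by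
  have hne : {k : ℕ | ∃ S : Finset V, IsAcyclicSet G S ∧ S.card = k}.Nonempty := by
    refine ⟨0, ∅, ?_, rfl⟩
    intro v
    exact absurd v.2 (by simp)
  have hbdd : BddAbove {k : ℕ | ∃ S : Finset V, IsAcyclicSet G S ∧ S.card = k} := by
    refine ⟨Fintype.card V, ?_⟩
    rintro k ⟨S, -, rfl⟩
    exact S.card_le_univ
  exact ⟨Nat.sSup_mem hne hbdd, fun k hk => le_csSup hbdd hk⟩

end InducedForest

/-! With m edges, the stronger inequality 29a - 25n + 5m ≥ 0 holds for every triangle-free graph,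
and m ≤ 2n then gives the claim. `excess` is twice the left side. Induction on the vertex set proves
it together with two bonuses: `excess` is at least 4 if some degree is at most 3, and at least 8 if
some degree is at most 2.

Three reductions carry the induction. Deleting a vertex of degree d gains 10d - 50
(`excess_delete`). Putting a vertex of degree d ≤ 1 into the forest gains 8 + 10d
(`excess_pendant`). Replacing a vertex of degree 2 by an edge between its neighbours gains 18
(`excess_contract`), and creates no triangle if they have no other common neighbour. Degrees of at
least 5 are deleted for free. Otherwise either a suppression is available, or deletions, often
around a 4-cycle, leave pendant vertices that repay their cost; a surviving vertex whose degree
dropped supplies a bonus where needed. -/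

namespace InducedForest

open Finset Classical

section

variable {V : Type*}

/-! ### Relative degrees and one-degenerate sets -/

/-- The neighbours of `v` inside `W`. -/
noncomputable def neighborsIn (G : SimpleGraph V) (W : Finset V) (v : V) : Finset V :=
  {u ∈ W | G.Adj v u}

theorem mem_neighborsIn {G : SimpleGraph V} {W : Finset V} {v u : V} :
    u ∈ neighborsIn G W v ↔ u ∈ W ∧ G.Adj v u :=
  mem_filter

/-- The number of neighbours of `v` inside `W`. -/
noncomputable def degreeIn (G : SimpleGraph V) (W : Finset V) (v : V) : ℕ :=
  #(neighborsIn G W v)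

/-- Every nonempty subset of `S` has a vertex with at most one neighbour in that subset. -/
def OneDegenerate (G : SimpleGraph V) (S : Finset V) : Prop :=
  ∀ T ⊆ S, T.Nonempty → ∃ t ∈ T, degreeIn G T t ≤ 1

/-- `G` has no triangle with all vertices in `W`. -/
def TriangleFreeOn (G : SimpleGraph V) (W : Finset V) : Prop :=
  ∀ a ∈ W, ∀ b ∈ W, ∀ c ∈ W, G.Adj a b → G.Adj a c → ¬ G.Adj b c

/-- The largest size of a one-degenerate subset of `W`. -/
noncomputable def forestCard (G : SimpleGraph V) (W : Finset V) : ℕ :=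
  {S ∈ W.powerset | OneDegenerate G S}.sup card

/-- Twice `29 a - 25 n + 5 m` for the subgraph induced by `W`. -/
noncomputable def excess (G : SimpleGraph V) (W : Finset V) : ℤ :=
  58 * forestCard G W - 50 * #W + 5 * ∑ v ∈ W, (degreeIn G W v : ℤ)

variable {G : SimpleGraph V} {W : Finset V}

theorem TriangleFreeOn.mono {W' : Finset V} (h : TriangleFreeOn G W) (hs : W' ⊆ W) :
    TriangleFreeOn G W' :=
  fun a ha b hb c hc => h a (hs ha) b (hs hb) c (hs hc)

/-- On the support of a cycle every vertex has at least two neighbours. -/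
theorem OneDegenerate.isAcyclicSet {S : Finset V} (h : OneDegenerate G S) :
    IsAcyclicSet G S := by
  intro v c hc
  set T : Finset V := c.support.toFinset.image Subtype.val with hT
  have hTS : T ⊆ S := by
    intro x hx
    obtain ⟨y, -, rfl⟩ := mem_image.1 hx
    exact y.2
  obtain ⟨t, htT, ht⟩ := h T hTS ⟨v, mem_image.2 ⟨v, by simp, rfl⟩⟩
  obtain ⟨y, hy, rfl⟩ := mem_image.1 htT
  have h2 := hc.ncard_neighborSet_toSubgraph_eq_two (List.mem_toFinset.1 hy)
  have hsub : Subtype.val '' (c.toSubgraph.neighborSet y) ⊆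
      (neighborsIn G T y : Set V) := by
    rintro _ ⟨u, hu, rfl⟩
    have hadj : c.toSubgraph.Adj y u := hu
    have hmem : u ∈ c.support := c.mem_verts_toSubgraph.1 hadj.snd_mem
    exact mem_coe.2 (mem_neighborsIn.2 ⟨mem_image.2 ⟨u, List.mem_toFinset.2 hmem, rfl⟩,
      hadj.adj_sub⟩)
  have hle := Set.ncard_le_ncard hsub (finite_toSet _)
  rw [Set.ncard_image_of_injective _ Subtype.val_injective, h2, Set.ncard_coe_finset] at hle
  unfold degreeIn at ht
  omega

theorem exists_forestCard (G : SimpleGraph V) (W : Finset V) :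
    ∃ S ⊆ W, OneDegenerate G S ∧ #S = forestCard G W := by
  have hne : ({S ∈ W.powerset | OneDegenerate G S} : Finset (Finset V)).Nonempty :=
    ⟨∅, by
      simp only [mem_filter, mem_powerset, empty_subset, true_and]
      intro T hT hne
      exact absurd (subset_empty.1 hT) hne.ne_empty⟩
  obtain ⟨S, hS, h⟩ := exists_mem_eq_sup _ hne card
  rw [mem_filter, mem_powerset] at hS
  exact ⟨S, hS.1, hS.2, h.symm⟩

theorem le_forestCard {S : Finset V} (hs : S ⊆ W) (h : OneDegenerate G S) :
    #S ≤ forestCard G W :=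
  le_sup (f := card) (mem_filter.2 ⟨mem_powerset.2 hs, h⟩)

theorem degreeIn_mono {T : Finset V} (h : T ⊆ W) (v : V) : degreeIn G T v ≤ degreeIn G W v :=
  card_le_card (filter_subset_filter _ h)

/-! ### Deleting a vertex -/

theorem degreeIn_erase_of_adj {x t : V} (hx : x ∈ W) (h : G.Adj t x) :
    degreeIn G (W.erase x) t + 1 = degreeIn G W t := by
  unfold degreeIn neighborsIn
  rw [filter_erase, card_erase_add_one (mem_filter.2 ⟨hx, h⟩)]

theorem degreeIn_erase_of_not_adj {x t : V} (h : ¬ G.Adj t x) :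
    degreeIn G (W.erase x) t = degreeIn G W t := by
  unfold degreeIn neighborsIn
  rw [filter_erase, erase_eq_of_notMem (by simp [h])]

theorem degreeIn_erase_le (x t : V) : degreeIn G (W.erase x) t ≤ degreeIn G W t :=
  degreeIn_mono (erase_subset _ _) _

theorem sum_degreeIn_erase {v : V} (hv : v ∈ W) :
    ∑ u ∈ W, (degreeIn G W u : ℤ) =
      ∑ u ∈ W.erase v, (degreeIn G (W.erase v) u : ℤ) + 2 * degreeIn G W v := by
  rw [← add_sum_erase W _ hv]
  have h1 : ∀ u ∈ W.erase v, (degreeIn G W u : ℤ) =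
      degreeIn G (W.erase v) u + if G.Adj v u then 1 else 0 := by
    intro u _
    split_ifs with h
    · rw [← degreeIn_erase_of_adj hv h.symm]; push_cast; rfl
    · rw [degreeIn_erase_of_not_adj (fun h' => h h'.symm)]; simp
  rw [sum_congr rfl h1, sum_add_distrib, sum_boole]
  have h2 : #{u ∈ W.erase v | G.Adj v u} = degreeIn G W v :=
    degreeIn_erase_of_not_adj (G.loopless.irrefl v)
  rw [h2]
  ring

theorem forestCard_erase_le (v : V) : forestCard G (W.erase v) ≤ forestCard G W := by
  obtain ⟨S, hS, hd, hc⟩ := exists_forestCard G (W.erase v)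
  exact hc ▸ le_forestCard (hS.trans (erase_subset _ _)) hd

theorem excess_delete {v : V} (hv : v ∈ W) :
    excess G (W.erase v) + 10 * degreeIn G W v ≤ excess G W + 50 := by
  have h1 := forestCard_erase_le (G := G) (W := W) v
  have h2 := sum_degreeIn_erase (G := G) hv
  have h3 := card_erase_add_one hv
  unfold excess
  rw [h2]
  omega

/-- A vertex with at most one neighbour closes no cycle, so it extends every forest; 8 = 58 - 50. -/
theorem excess_pendant {v : V} (hv : v ∈ W) (hd : degreeIn G W v ≤ 1) :
    excess G (W.erase v) + 8 + 10 * degreeIn G W v ≤ excess G W := by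
  obtain ⟨S, hS, hdeg, hc⟩ := exists_forestCard G (W.erase v)
  have hvS : v ∉ S := fun h => by simpa using hS h
  have hsub : insert v S ⊆ W := insert_subset hv (hS.trans (erase_subset _ _))
  have h1 : #(insert v S) ≤ forestCard G W := by
    refine le_forestCard hsub fun T hT hne => ?_
    by_cases hvT : v ∈ T
    · exact ⟨v, hvT, (degreeIn_mono (hT.trans hsub) v).trans hd⟩
    · exact hdeg T ((subset_insert_iff_of_notMem hvT).1 hT) hne
  rw [card_insert_of_notMem hvS] at h1
  have h2 := sum_degreeIn_erase (G := G) hv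
  have h3 := card_erase_add_one hv
  unfold excess
  rw [h2]
  omega

/-! ### Suppressing a vertex of degree two -/

theorem sup_edge_adj_iff {y z a b : V} (hyz : y ≠ z) :
    (G ⊔ SimpleGraph.edge y z).Adj a b ↔
      G.Adj a b ∨ (a = y ∧ b = z) ∨ (a = z ∧ b = y) := by
  rw [SimpleGraph.sup_adj, SimpleGraph.edge_adj]
  grind

theorem degreeIn_sup_edge_of_ne {y z t : V} (hyz : y ≠ z) (hy : t ≠ y) (hz : t ≠ z) :
    degreeIn (G ⊔ SimpleGraph.edge y z) W t = degreeIn G W t := by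
  unfold degreeIn
  congr 1
  ext u
  simp only [mem_neighborsIn, sup_edge_adj_iff hyz]
  grind

theorem degreeIn_sup_edge_left {y z : V} (hyz : y ≠ z) (hz : z ∈ W) (h : ¬ G.Adj y z) :
    degreeIn (G ⊔ SimpleGraph.edge y z) W y = degreeIn G W y + 1 := by
  unfold degreeIn
  rw [← card_insert_of_notMem (a := z) (by simp [mem_neighborsIn, h])]
  congr 1
  ext u
  simp only [mem_insert, mem_neighborsIn, sup_edge_adj_iff hyz]
  grind

theorem sum_degreeIn_sup_edge {y z : V} (hyz : y ≠ z) (hy : y ∈ W) (hz : z ∈ W)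
    (h : ¬ G.Adj y z) :
    ∑ u ∈ W, (degreeIn (G ⊔ SimpleGraph.edge y z) W u : ℤ) =
      ∑ u ∈ W, (degreeIn G W u : ℤ) + 2 := by
  have hz' : z ∈ W.erase y := mem_erase.2 ⟨hyz.symm, hz⟩
  have hr : degreeIn (G ⊔ SimpleGraph.edge y z) W z = degreeIn G W z + 1 := by
    rw [SimpleGraph.edge_comm]
    exact degreeIn_sup_edge_left hyz.symm hy (fun h' => h h'.symm)
  rw [← add_sum_erase W _ hy, ← add_sum_erase _ _ hz', ← add_sum_erase W _ hy,
    ← add_sum_erase _ _ hz', degreeIn_sup_edge_left hyz hz h, hr,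
    sum_congr rfl fun u hu => by
      rw [degreeIn_sup_edge_of_ne hyz (ne_of_mem_erase (mem_of_mem_erase hu))
        (ne_of_mem_erase hu)]]
  push_cast
  ring

/-- A cycle through `v` would pass along y, v, z; shortcutting by the new edge gives a cycle
avoiding `v`. -/
theorem OneDegenerate.insert_of_sup_edge {S : Finset V} {v y z : V} (hyz : y ≠ z)
    (hnadj : ¬ G.Adj y z)
    (hN : ∀ t ∈ S, G.Adj v t → t = y ∨ t = z)
    (h : OneDegenerate (G ⊔ SimpleGraph.edge y z) S) : OneDegenerate G (insert v S) := by
  have hle : ∀ (T : Finset V) (t : V),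
      degreeIn G T t ≤ degreeIn (G ⊔ SimpleGraph.edge y z) T t := fun T t =>
    card_le_card fun u hu => by
      rw [mem_neighborsIn] at hu ⊢
      exact ⟨hu.1, Or.inl hu.2⟩
  intro T hT hne
  by_cases hvT : v ∈ T
  swap
  · obtain ⟨t, ht, hd⟩ := h T ((subset_insert_iff_of_notMem hvT).1 hT) hne
    exact ⟨t, ht, (hle T t).trans hd⟩
  by_cases hv1 : degreeIn G T v ≤ 1
  · exact ⟨v, hvT, hv1⟩
  have hTS : T.erase v ⊆ S := subset_insert_iff.1 hT
  have hsub : neighborsIn G T v ⊆ {y, z} := by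
    intro u hu
    rw [mem_neighborsIn] at hu
    have := hN u (hTS (mem_erase.2 ⟨hu.2.ne', hu.1⟩)) hu.2
    simpa using this
  have heq : neighborsIn G T v = {y, z} := by
    refine eq_of_subset_of_card_le hsub ?_
    rw [card_pair hyz]
    unfold degreeIn at hv1
    omega
  have hy : y ∈ T ∧ G.Adj v y := by
    rw [← mem_neighborsIn, heq]; simp
  have hz : z ∈ T ∧ G.Adj v z := by
    rw [← mem_neighborsIn, heq]; simp
  have hy' : y ∈ T.erase v := mem_erase.2 ⟨hy.2.ne', hy.1⟩
  have hz' : z ∈ T.erase v := mem_erase.2 ⟨hz.2.ne', hz.1⟩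
  -- Passing back to `T`, `y` and `z` trade the new edge for the edge to `v`, so the low-degree
  -- vertex keeps its degree.
  obtain ⟨t, ht, hd⟩ := h _ hTS ⟨y, hy'⟩
  refine ⟨t, mem_of_mem_erase ht, ?_⟩
  by_cases hty : t = y
  · subst hty
    rw [degreeIn_sup_edge_left hyz hz' hnadj] at hd
    have := degreeIn_erase_of_adj hvT hy.2.symm
    omega
  by_cases htz : t = z
  · subst htz
    rw [SimpleGraph.edge_comm,
      degreeIn_sup_edge_left hyz.symm hy' (fun h' => hnadj h'.symm)] at hd
    have := degreeIn_erase_of_adj hvT hz.2.symm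
    omega
  rw [degreeIn_sup_edge_of_ne hyz hty htz, degreeIn_erase_of_not_adj] at hd
  · exact hd
  · intro hadj
    rcases hN t (hTS ht) hadj.symm with h1 | h1 <;> contradiction

/-- The forest gains `v` and two edges are traded for one: 58 - 50 + 10 = 18. -/
theorem excess_contract {v y z : V} (hv : v ∈ W) (hy : y ∈ W) (hz : z ∈ W) (hyz : y ≠ z)
    (hvy : G.Adj v y) (hvz : G.Adj v z) (hnadj : ¬ G.Adj y z)
    (hN : ∀ t ∈ W, G.Adj v t → t = y ∨ t = z) :
    excess (G ⊔ SimpleGraph.edge y z) (W.erase v) + 18 ≤ excess G W := by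
  obtain ⟨S, hS, hdeg, hc⟩ := exists_forestCard (G ⊔ SimpleGraph.edge y z) (W.erase v)
  have hvS : v ∉ S := fun h => by simpa using hS h
  have hsub : insert v S ⊆ W := insert_subset hv (hS.trans (erase_subset _ _))
  have h1 : #(insert v S) ≤ forestCard G W :=
    le_forestCard hsub (hdeg.insert_of_sup_edge hyz hnadj
      fun t ht => hN t (mem_of_mem_erase (hS ht)))
  rw [card_insert_of_notMem hvS] at h1
  have h2 := sum_degreeIn_erase (G := G) hv
  have h3 := card_erase_add_one hv
  have h4 := sum_degreeIn_sup_edge (G := G) hyz (mem_erase.2 ⟨hvy.ne', hy⟩)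
    (mem_erase.2 ⟨hvz.ne', hz⟩) hnadj
  have h5 : 2 ≤ degreeIn G W v := by
    rw [← card_pair hyz]
    refine card_le_card ?_
    intro u hu
    rcases mem_insert.1 hu with rfl | hu
    · exact mem_neighborsIn.2 ⟨hy, hvy⟩
    · rw [mem_singleton.1 hu]; exact mem_neighborsIn.2 ⟨hz, hvz⟩
  unfold excess
  rw [h2, h4]
  omega

/-- A new triangle would consist of the new edge and a common neighbour of its ends. -/
theorem TriangleFreeOn.sup_edge {y z : V} (h : TriangleFreeOn G W) (hyz : y ≠ z)
    (hN : ∀ t ∈ W, G.Adj y t → ¬ G.Adj z t) :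
    TriangleFreeOn (G ⊔ SimpleGraph.edge y z) W := by
  intro a ha b hb c hc
  simp only [sup_edge_adj_iff hyz]
  have h0 := h a ha b hb c hc
  have h1 := hN a ha
  have h2 := hN b hb
  have h3 := hN c hc
  have := G.adj_comm a b
  have := G.adj_comm a c
  have := G.adj_comm b c
  have := G.loopless.irrefl
  grind

/-! ### Choosing neighbours -/

theorem degreeIn_erase {x : V} (hx : x ∈ W) (t : V) :
    degreeIn G (W.erase x) t + (if G.Adj t x then 1 else 0) = degreeIn G W t := by
  split_ifs with h
  · exact degreeIn_erase_of_adj hx h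
  · exact degreeIn_erase_of_not_adj h

theorem exists_adj_notMem {v : V} (s : Finset V) (h : #s < degreeIn G W v) :
    ∃ x ∈ W, G.Adj v x ∧ x ∉ s := by
  obtain ⟨x, hx, hxs⟩ := exists_mem_notMem_of_card_lt_card h
  rw [mem_neighborsIn] at hx
  exact ⟨x, hx.1, hx.2, hxs⟩

theorem mem_of_adj_of_degreeIn_le {v : V} {s : Finset V} (hs : ∀ x ∈ s, x ∈ W ∧ G.Adj v x)
    (h : degreeIn G W v ≤ #s) {t : V} (ht : t ∈ W) (hvt : G.Adj v t) : t ∈ s := by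
  have : s = neighborsIn G W v :=
    eq_of_subset_of_card_le (fun x hx => mem_neighborsIn.2 (hs x hx)) h
  rw [this, mem_neighborsIn]
  exact ⟨ht, hvt⟩

theorem exists_adj_pair {v : V} (h : degreeIn G W v = 2) :
    ∃ x ∈ W, ∃ y ∈ W, x ≠ y ∧ G.Adj v x ∧ G.Adj v y := by
  obtain ⟨x, hx, hvx, -⟩ := exists_adj_notMem (G := G) (W := W) (v := v) ∅ (by simp [h])
  obtain ⟨y, hy, hvy, hyx⟩ := exists_adj_notMem (G := G) (W := W) (v := v) {x} (by simp [h])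
  exact ⟨x, hx, y, hy, fun h => hyx (by simp [h]), hvx, hvy⟩

/-! ### The induction hypothesis -/

/-- The lower bounds on the excess that are proved simultaneously by induction. -/
def ExcessBounds (G : SimpleGraph V) (W : Finset V) : Prop :=
  0 ≤ excess G W ∧ (∀ u ∈ W, degreeIn G W u ≤ 3 → 4 ≤ excess G W) ∧
    ∀ u ∈ W, degreeIn G W u ≤ 2 → 8 ≤ excess G W

/-- The bounds hold for all triangle-free graphs on proper subsets of `W`. -/
def BoundsBelow (W : Finset V) : Prop :=
  ∀ (G : SimpleGraph V), ∀ W' ⊂ W, TriangleFreeOn G W' → ExcessBounds G W'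

theorem BoundsBelow.of_subset_erase (ih : BoundsBelow W) (h3 : TriangleFreeOn G W) {v : V}
    (hv : v ∈ W) {W' : Finset V} (hs : W' ⊆ W.erase v) : ExcessBounds G W' :=
  ih G W' (hs.trans_ssubset (erase_ssubset hv)) (h3.mono (hs.trans (erase_subset _ _)))

/-- A vertex of degree two whose neighbours have no other common neighbour is suppressed. -/
theorem BoundsBelow.suppress {U : Finset V} (ih : BoundsBelow W) (hU : U ⊆ W)
    (h3 : TriangleFreeOn G U) {v y z : V} (hv : v ∈ U) (hy : y ∈ U) (hz : z ∈ U) (hyz : y ≠ z)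
    (hvy : G.Adj v y) (hvz : G.Adj v z) (hd : degreeIn G U v ≤ 2)
    (hc : ∀ t ∈ U, G.Adj y t → G.Adj z t → t = v) :
    18 ≤ excess G U ∧
      (∀ u ∈ U, u ≠ v → u ≠ y → u ≠ z → ¬ G.Adj u v → degreeIn G U u ≤ 3 → 22 ≤ excess G U) ∧
      ∀ u ∈ U, u ≠ v → u ≠ y → u ≠ z → ¬ G.Adj u v → degreeIn G U u ≤ 2 → 26 ≤ excess G U := by
  have hnadj := h3 v hv y hy z hz hvy hvz
  have h1 := excess_contract hv hy hz hyz hvy hvz hnadj fun t ht hvt => by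
    have := mem_of_adj_of_degreeIn_le (s := {y, z}) (t := t) (by simp [*])
      (by rwa [card_pair hyz]) ht hvt
    simpa using this
  -- The graph itself changes here, which is why `BoundsBelow` ranges over all graphs.
  have h2 : ExcessBounds (G ⊔ SimpleGraph.edge y z) (U.erase v) := by
    refine ih _ _ ((erase_ssubset hv).trans_subset hU)
      ((h3.mono (erase_subset _ _)).sup_edge hyz fun t ht h4 h5 => ?_)
    exact ne_of_mem_erase ht (hc t (mem_of_mem_erase ht) h4 h5)
  have h4 : ∀ u, u ≠ y → u ≠ z → ¬ G.Adj u v →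
      degreeIn (G ⊔ SimpleGraph.edge y z) (U.erase v) u = degreeIn G U u := fun u h5 h6 h7 => by
    rw [degreeIn_sup_edge_of_ne hyz h5 h6, degreeIn_erase_of_not_adj h7]
  refine ⟨by linarith [h2.1], fun u hu h5 h6 h7 h8 h9 => ?_, fun u hu h5 h6 h7 h8 h9 => ?_⟩
  · linarith [h2.2.1 u (mem_erase.2 ⟨h5, hu⟩) (by rwa [h4 u h6 h7 h8])]
  · linarith [h2.2.2 u (mem_erase.2 ⟨h5, hu⟩) (by rwa [h4 u h6 h7 h8])]

/-! ### Vertices of degree at most two -/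

/-- A four-cycle through a vertex of degree two whose neighbours have degree three. -/
theorem eight_le_excess_of_four_cycle (ih : BoundsBelow W) (h3 : TriangleFreeOn G W)
    (hmax : ∀ t ∈ W, degreeIn G W t ≤ 4) {u x y z p : V} (hu : u ∈ W) (hx : x ∈ W) (hy : y ∈ W)
    (hz : z ∈ W) (hp : p ∈ W) (hxy : x ≠ y) (hzu : z ≠ u) (hpu : p ≠ u) (hpz : p ≠ z)
    (hux : G.Adj u x) (huy : G.Adj u y) (hxz : G.Adj x z) (hyz : G.Adj y z) (hxp : G.Adj x p)
    (hdu : degreeIn G W u = 2) (hdx : degreeIn G W x = 3) (hdy : degreeIn G W y = 3)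
    (hdz : 3 ≤ degreeIn G W z) (hdp : 3 ≤ degreeIn G W p) : 8 ≤ excess G W := by
  have hnxy := h3 u hu x hx y hy hux huy
  -- Losing `z` leaves `q` with degree at most 3. The worst balance, with `p` adjacent to `y`, is
  -- -20 - 20 + 18 + 18 + 8 + 4 = 8.
  obtain ⟨q, hq, hzq, hqn⟩ := exists_adj_notMem (G := G) (W := W) (v := z) {x, y}
    (by have := card_le_two (a := x) (b := y); omega)
  simp only [mem_insert, mem_singleton, not_or] at hqn
  have hq4 := hmax q hq
  clear hmax
  have hnuz := h3 x hx u hu z hz hux.symm hxz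
  have hnzp := h3 x hx z hz p hp hxz hxp
  have hnup := h3 x hx u hu p hp hux.symm hxp
  have e1 := excess_delete (G := G) hz
  have e2 := excess_delete (G := G) (W := W.erase z) (v := p)
    (by grind [SimpleGraph.adj_comm, SimpleGraph.irrefl])
  have e3 := excess_pendant (G := G) (W := (W.erase z).erase p) (v := x)
    (by grind [SimpleGraph.adj_comm, SimpleGraph.irrefl])
    (by grind [degreeIn_erase, SimpleGraph.adj_comm, SimpleGraph.irrefl])
  have e4 := excess_pendant (G := G) (W := ((W.erase z).erase p).erase x) (v := u)
    (by grind [SimpleGraph.adj_comm, SimpleGraph.irrefl])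
    (by grind [degreeIn_erase, SimpleGraph.adj_comm, SimpleGraph.irrefl])
  have e5 := excess_pendant (G := G) (W := (((W.erase z).erase p).erase x).erase u) (v := y)
    (by grind [SimpleGraph.adj_comm, SimpleGraph.irrefl])
    (by grind [degreeIn_erase, SimpleGraph.adj_comm, SimpleGraph.irrefl])
  have hsub : ((((W.erase z).erase p).erase x).erase u).erase y ⊆ W.erase z := by grind
  have e6 := (ih.of_subset_erase h3 hz hsub).2.1 q
    (by grind [SimpleGraph.adj_comm, SimpleGraph.irrefl])
    ((degreeIn_mono hsub q).trans
    (by grind [degreeIn_erase, SimpleGraph.adj_comm, SimpleGraph.irrefl]))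
  grind [degreeIn_erase, SimpleGraph.adj_comm, SimpleGraph.irrefl]

/-- A vertex of degree at most two in a graph of maximum degree at most four. -/
theorem eight_le_excess_of_degreeIn_le_two (ih : BoundsBelow W) (h3 : TriangleFreeOn G W)
    (hmax : ∀ t ∈ W, degreeIn G W t ≤ 4) {u : V} (hu : u ∈ W) (hd : degreeIn G W u ≤ 2) :
    8 ≤ excess G W := by
  by_cases hle : ∃ t ∈ W, degreeIn G W t ≤ 1
  · obtain ⟨t, ht, hd1⟩ := hle
    have := excess_pendant ht hd1
    have := (ih.of_subset_erase h3 ht subset_rfl).1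
    omega
  have hmin : ∀ t ∈ W, 2 ≤ degreeIn G W t := fun t ht => by
    by_contra h
    exact hle ⟨t, ht, by omega⟩
  have hu2 : degreeIn G W u = 2 := le_antisymm hd (hmin u hu)
  obtain ⟨x, hx, y, hy, hxy, hux, huy⟩ := exists_adj_pair hu2
  by_cases hc : ∀ t ∈ W, G.Adj x t → G.Adj y t → t = u
  · have := (ih.suppress subset_rfl h3 hu hx hy hxy hux huy hd hc).1
    omega
  push Not at hc
  obtain ⟨z, hz, hxz, hyz, hzu⟩ := hc
  have key4 : ∀ a ∈ W, G.Adj u a → degreeIn G W a = 4 → 8 ≤ excess G W := by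
    intro a ha hua h4
    -- Balance: -10 + 18 = 8.
    have h1 := excess_delete (G := G) ha
    have h2 := degreeIn_erase (G := G) ha u
    have h5 := excess_pendant (G := G) (W := W.erase a) (v := u) (by simp [hu, hua.ne])
      (by rw [if_pos hua] at h2; omega)
    have h6 := (ih.of_subset_erase h3 ha (erase_subset u (W.erase a))).1
    rw [if_pos hua] at h2
    omega
  have key2 : ∀ a ∈ W, ∀ b ∈ W, G.Adj u a → G.Adj u b → a ≠ b → G.Adj a z → G.Adj b z →
      degreeIn G W a = 2 → degreeIn G W b ≤ 3 → 8 ≤ excess G W := by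
    intro a ha b hb hua hub hab haz hbz hda hdb
    have hnab := h3 u hu a ha b hb hua hub
    have hnuz := h3 a ha u hu z hz hua.symm haz
    -- Balance: at least -30 + 18 + 18 + 8 = 14.
    have e1 := excess_delete (G := G) hz
    have hz2 := hmin z hz
    have e2 := excess_pendant (G := G) (W := W.erase z) (v := a)
      (by grind [SimpleGraph.adj_comm, SimpleGraph.irrefl])
      (by grind [degreeIn_erase, SimpleGraph.adj_comm, SimpleGraph.irrefl])
    have e3 := excess_pendant (G := G) (W := (W.erase z).erase a) (v := u)
      (by grind [SimpleGraph.adj_comm, SimpleGraph.irrefl])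
      (by grind [degreeIn_erase, SimpleGraph.adj_comm, SimpleGraph.irrefl])
    have e4 := excess_pendant (G := G) (W := ((W.erase z).erase a).erase u) (v := b)
      (by grind [SimpleGraph.adj_comm, SimpleGraph.irrefl])
      (by grind [degreeIn_erase, SimpleGraph.adj_comm, SimpleGraph.irrefl])
    have e5 := (ih.of_subset_erase h3 hz (W' := (((W.erase z).erase a).erase u).erase b)
      (by grind [SimpleGraph.adj_comm, SimpleGraph.irrefl])).1
    grind [degreeIn_erase, SimpleGraph.adj_comm, SimpleGraph.irrefl]
  have hx2 := hmin x hx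
  have hy2 := hmin y hy
  have hx4 := hmax x hx
  have hy4 := hmax y hy
  by_cases hx4' : degreeIn G W x = 4
  · exact key4 x hx hux hx4'
  by_cases hy4' : degreeIn G W y = 4
  · exact key4 y hy huy hy4'
  by_cases hx2' : degreeIn G W x = 2
  · exact key2 x hx y hy hux huy hxy hxz hyz hx2' (by omega)
  have hdx : degreeIn G W x = 3 := by omega
  by_cases hy2' : degreeIn G W y = 2
  · exact key2 y hy x hx huy hux hxy.symm hyz hxz hy2' (by omega)
  have hdy : degreeIn G W y = 3 := by omega
  have key3 : ∀ t ∈ W, G.Adj x t → t ≠ u → degreeIn G W t = 2 → 8 ≤ excess G W := by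
    intro t ht hxt htu hdt
    have hnut := h3 x hx u hu t ht hux.symm hxt
    -- Balance: -20 + 18 + 18 = 16.
    have e1 := excess_delete (G := G) hx
    have e2 := excess_pendant (G := G) (W := W.erase x) (v := u)
      (by grind [SimpleGraph.adj_comm, SimpleGraph.irrefl])
      (by grind [degreeIn_erase, SimpleGraph.adj_comm, SimpleGraph.irrefl])
    have e3 := excess_pendant (G := G) (W := (W.erase x).erase u) (v := t)
      (by grind [SimpleGraph.adj_comm, SimpleGraph.irrefl])
      (by grind [degreeIn_erase, SimpleGraph.adj_comm, SimpleGraph.irrefl])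
    have e4 := (ih.of_subset_erase h3 hx (W' := ((W.erase x).erase u).erase t)
      (by grind [SimpleGraph.adj_comm, SimpleGraph.irrefl])).1
    grind [degreeIn_erase, SimpleGraph.adj_comm, SimpleGraph.irrefl]
  obtain ⟨p, hp, hxp, hpn⟩ := exists_adj_notMem (G := G) (W := W) (v := x) {u, z}
    (by have := card_le_two (a := u) (b := z); omega)
  simp only [mem_insert, mem_singleton, not_or] at hpn
  have hz2 := hmin z hz
  by_cases hz2' : degreeIn G W z = 2
  · exact key3 z hz hxz hzu hz2'
  have hp2 := hmin p hp
  by_cases hp2' : degreeIn G W p = 2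
  · exact key3 p hp hxp hpn.1 hp2'
  exact eight_le_excess_of_four_cycle ih h3 hmax hu hx hy hz hp hxy hzu hpn.1 hpn.2 hux huy hxz
    hyz hxp hu2 hdx hdy (by omega) (by omega)

/-! ### Vertices of degree three -/

/-- Two vertices of degree three with two common neighbours of large total degree. -/
theorem four_le_excess_of_opposite (ih : BoundsBelow W) (h3 : TriangleFreeOn G W) {v w y z : V}
    (hv : v ∈ W) (hw : w ∈ W) (hy : y ∈ W) (hz : z ∈ W) (hvw : v ≠ w) (hyz : y ≠ z)
    (hvy : G.Adj v y) (hvz : G.Adj v z) (hwy : G.Adj w y) (hwz : G.Adj w z)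
    (hdy : degreeIn G W y = 3) (hdz : degreeIn G W z = 3)
    (hd : 7 ≤ degreeIn G W v + degreeIn G W w) : 4 ≤ excess G W := by
  have hnyz := h3 v hv y hy z hz hvy hvz
  have hnvw := h3 y hy v hv w hw hvy.symm hwy.symm
  -- Balance: at least -30 + 18 + 18 = 6.
  have e1 := excess_delete (G := G) hv
  have e2 := excess_delete (G := G) (W := W.erase v) (v := w)
    (by grind [SimpleGraph.adj_comm, SimpleGraph.irrefl])
  have e3 := excess_pendant (G := G) (W := (W.erase v).erase w) (v := y)
    (by grind [SimpleGraph.adj_comm, SimpleGraph.irrefl])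
    (by grind [degreeIn_erase, SimpleGraph.adj_comm, SimpleGraph.irrefl])
  have e4 := excess_pendant (G := G) (W := ((W.erase v).erase w).erase y) (v := z)
    (by grind [SimpleGraph.adj_comm, SimpleGraph.irrefl])
    (by grind [degreeIn_erase, SimpleGraph.adj_comm, SimpleGraph.irrefl])
  have e5 := (ih.of_subset_erase h3 hv (W' := (((W.erase v).erase w).erase y).erase z)
    (by grind [SimpleGraph.adj_comm, SimpleGraph.irrefl])).1
  grind [degreeIn_erase, SimpleGraph.adj_comm, SimpleGraph.irrefl]

/-- A four-cycle of vertices of degree three with another neighbour of degree three. -/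
theorem four_le_excess_of_cubic_four_cycle_of_adj (ih : BoundsBelow W) (h3 : TriangleFreeOn G W)
    {a b c d t : V} (ha : a ∈ W) (hb : b ∈ W) (hc : c ∈ W) (hd : d ∈ W) (ht : t ∈ W)
    (hab : a ≠ b) (hcd : c ≠ d) (hac : G.Adj a c) (had : G.Adj a d) (hbc : G.Adj b c)
    (hbd : G.Adj b d) (hda : degreeIn G W a = 3) (hdb : degreeIn G W b = 3)
    (hdc : degreeIn G W c = 3) (hdd : degreeIn G W d = 3) (hat : G.Adj a t) (htc : t ≠ c)
    (htd : t ≠ d) (hdt : degreeIn G W t = 3) : 4 ≤ excess G W := by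
  have hncd := h3 a ha c hc d hd hac had
  have hnab := h3 c hc a ha b hb hac.symm hbc.symm
  -- Balance: -40 + 18 + 18 = -4, and `t`, having lost `a`, supplies the bonus 8.
  have e1 := excess_delete (G := G) hc
  have e2 := excess_delete (G := G) (W := W.erase c) (v := d)
    (by grind [SimpleGraph.adj_comm, SimpleGraph.irrefl])
  have e3 := excess_pendant (G := G) (W := (W.erase c).erase d) (v := a)
    (by grind [SimpleGraph.adj_comm, SimpleGraph.irrefl])
    (by grind [degreeIn_erase, SimpleGraph.adj_comm, SimpleGraph.irrefl])
  have e4 := excess_pendant (G := G) (W := ((W.erase c).erase d).erase a) (v := b)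
    (by grind [SimpleGraph.adj_comm, SimpleGraph.irrefl])
    (by grind [degreeIn_erase, SimpleGraph.adj_comm, SimpleGraph.irrefl])
  have hsub : (((W.erase c).erase d).erase a).erase b ⊆ W.erase a := by grind
  have e5 := (ih.of_subset_erase h3 ha hsub).2.2 t
    (by grind [SimpleGraph.adj_comm, SimpleGraph.irrefl])
    ((degreeIn_mono hsub t).trans
    (by grind [degreeIn_erase, SimpleGraph.adj_comm, SimpleGraph.irrefl]))
  grind [degreeIn_erase, SimpleGraph.adj_comm, SimpleGraph.irrefl]

/-- A four-cycle of vertices of degree three. -/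
theorem four_le_excess_of_cubic_four_cycle (ih : BoundsBelow W) (h3 : TriangleFreeOn G W)
    (hmin : ∀ t ∈ W, 3 ≤ degreeIn G W t) {v w y z : V}
    (hv : v ∈ W) (hw : w ∈ W) (hy : y ∈ W) (hz : z ∈ W) (hvw : v ≠ w) (hyz : y ≠ z)
    (hvy : G.Adj v y) (hvz : G.Adj v z) (hwy : G.Adj w y) (hwz : G.Adj w z)
    (hdv : degreeIn G W v = 3) (hdw : degreeIn G W w = 3)
    (hdy : degreeIn G W y = 3) (hdz : degreeIn G W z = 3) : 4 ≤ excess G W := by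
  obtain ⟨x, hx, hvx, hxn⟩ := exists_adj_notMem (G := G) (W := W) (v := v) {y, z}
    (by have := card_le_two (a := y) (b := z); omega)
  obtain ⟨p, hp, hzp, hpn⟩ := exists_adj_notMem (G := G) (W := W) (v := z) {v, w}
    (by have := card_le_two (a := v) (b := w); omega)
  simp only [mem_insert, mem_singleton, not_or] at hxn hpn
  have hx3 := hmin x hx
  have hp3 := hmin p hp
  by_cases hdx : degreeIn G W x = 3
  · exact four_le_excess_of_cubic_four_cycle_of_adj ih h3 hv hw hy hz hx hvw hyz hvy hvz
      hwy hwz hdv hdw hdy hdz hvx hxn.1 hxn.2 hdx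
  by_cases hdp : degreeIn G W p = 3
  · exact four_le_excess_of_cubic_four_cycle_of_adj ih h3 hz hy hv hw hp hyz.symm hvw
      hvz.symm hwz.symm hvy.symm hwy.symm hdz hdy hdv hdw hzp hpn.1 hpn.2 hdp
  by_cases hwx : G.Adj w x
  · exact four_le_excess_of_opposite ih h3 hx hy hv hw hxn.1 hvw hvx.symm hwx.symm hvy.symm
      hwy.symm hdv hdw (by omega)
  by_cases hyp : G.Adj y p
  · exact four_le_excess_of_opposite ih h3 hp hv hz hy hpn.1 hyz.symm hzp.symm hyp.symm hvz
      hvy hdz hdy (by omega)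
  have hnyz := h3 v hv y hy z hz hvy hvz
  have hnvw := h3 y hy v hv w hw hvy.symm hwy.symm
  have hnxy := h3 v hv x hx y hy hvx hvy
  have hnxz := h3 v hv x hx z hz hvx hvz
  have hnvp := h3 z hz v hv p hp hvz.symm hzp
  have hnwp := h3 z hz w hw p hp hwz.symm hzp
  clear hmin
  -- Worst balance, with `x` adjacent to `p`: -10 - 20 + 18 - 20 + 18 + 18 = 4.
  have e1 := excess_delete (G := G) hx
  have e2 := excess_delete (G := G) (W := W.erase x) (v := y)
    (by grind [SimpleGraph.adj_comm, SimpleGraph.irrefl])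
  have e3 := excess_pendant (G := G) (W := (W.erase x).erase y) (v := v)
    (by grind [SimpleGraph.adj_comm, SimpleGraph.irrefl])
    (by grind [degreeIn_erase, SimpleGraph.adj_comm, SimpleGraph.irrefl])
  have e4 := excess_delete (G := G) (W := ((W.erase x).erase y).erase v) (v := p)
    (by grind [SimpleGraph.adj_comm, SimpleGraph.irrefl])
  have e5 := excess_pendant (G := G) (W := (((W.erase x).erase y).erase v).erase p) (v := z)
    (by grind [SimpleGraph.adj_comm, SimpleGraph.irrefl])
    (by grind [degreeIn_erase, SimpleGraph.adj_comm, SimpleGraph.irrefl])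
  have e6 := excess_pendant (G := G) (W := ((((W.erase x).erase y).erase v).erase p).erase z)
    (v := w) (by grind [SimpleGraph.adj_comm, SimpleGraph.irrefl])
    (by grind [degreeIn_erase, SimpleGraph.adj_comm, SimpleGraph.irrefl])
  have e7 := (ih.of_subset_erase h3 hx
    (W' := (((((W.erase x).erase y).erase v).erase p).erase z).erase w)
    (by grind [SimpleGraph.adj_comm, SimpleGraph.irrefl])).1
  grind [degreeIn_erase, SimpleGraph.adj_comm, SimpleGraph.irrefl]

/-- Deleting two neighbours of degree four of a vertex of degree three. -/
theorem four_le_excess_of_two_adj_degree_four (ih : BoundsBelow W) (h3 : TriangleFreeOn G W)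
    {v x z t : V} (hv : v ∈ W) (hx : x ∈ W) (hz : z ∈ W) (ht : t ∈ W) (hxz : x ≠ z)
    (hvx : G.Adj v x) (hvz : G.Adj v z) (hdv : degreeIn G W v = 3)
    (hdx : degreeIn G W x = 4) (hdz : degreeIn G W z = 4) (htv : t ≠ v) (htx : t ≠ x)
    (htz : t ≠ z)
    (hdt : degreeIn G (((W.erase x).erase z).erase v) t ≤ 2) : 4 ≤ excess G W := by
  have hnxz := h3 v hv x hx z hz hvx hvz
  -- Balance: -10 - 10 + 18 + 8 = 6, the 8 being the bonus from `t`.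
  have e1 := excess_delete (G := G) hx
  have e2 := excess_delete (G := G) (W := W.erase x) (v := z)
    (by grind [SimpleGraph.adj_comm, SimpleGraph.irrefl])
  have e3 := excess_pendant (G := G) (W := (W.erase x).erase z) (v := v)
    (by grind [SimpleGraph.adj_comm, SimpleGraph.irrefl])
    (by grind [degreeIn_erase, SimpleGraph.adj_comm, SimpleGraph.irrefl])
  have e5 := (ih.of_subset_erase h3 hx (W' := ((W.erase x).erase z).erase v)
    (by grind [SimpleGraph.adj_comm, SimpleGraph.irrefl])).2.2 t
    (by grind [SimpleGraph.adj_comm, SimpleGraph.irrefl]) hdt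
  grind [degreeIn_erase, SimpleGraph.adj_comm, SimpleGraph.irrefl]

/-- Deleting one neighbour of a vertex of degree three and suppressing that vertex. -/
theorem BoundsBelow.delete_suppress (ih : BoundsBelow W) (h3 : TriangleFreeOn G W)
    {v x y z : V} (hv : v ∈ W) (hx : x ∈ W) (hy : y ∈ W) (hz : z ∈ W) (hxy : x ≠ y)
    (hxz : x ≠ z) (hyz : y ≠ z) (hvx : G.Adj v x) (hvy : G.Adj v y) (hvz : G.Adj v z)
    (hdv : degreeIn G W v = 3) (hc : ∀ t ∈ W, G.Adj y t → G.Adj z t → t = v) :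
    10 * (degreeIn G W x : ℤ) ≤ excess G W + 32 ∧
      ∀ t ∈ W, G.Adj x t → t ≠ v → degreeIn G W t ≤ 3 →
        10 * (degreeIn G W x : ℤ) ≤ excess G W + 24 := by
  have e1 := excess_delete (G := G) hx
  have e2 := ih.suppress (erase_subset x W) (h3.mono (erase_subset x W)) (v := v) (y := y)
    (z := z) (by grind [SimpleGraph.adj_comm, SimpleGraph.irrefl])
    (by grind [SimpleGraph.adj_comm, SimpleGraph.irrefl])
    (by grind [SimpleGraph.adj_comm, SimpleGraph.irrefl]) hyz hvy hvz
    (by grind [degreeIn_erase, SimpleGraph.adj_comm, SimpleGraph.irrefl])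
    (fun t ht => hc t (mem_of_mem_erase ht))
  refine ⟨by linarith [e2.1], fun t ht hxt htv hdt => ?_⟩
  have hnvt := h3 x hx v hv t ht hvx.symm hxt
  -- Without `x`, the vertex `t` has degree at most 2, which raises 18 to 26.
  have := e2.2.2 t (by grind [SimpleGraph.adj_comm, SimpleGraph.irrefl]) htv
    (by grind [SimpleGraph.adj_comm, SimpleGraph.irrefl])
    (by grind [SimpleGraph.adj_comm, SimpleGraph.irrefl])
    (by grind [SimpleGraph.adj_comm, SimpleGraph.irrefl])
    (by grind [degreeIn_erase, SimpleGraph.adj_comm, SimpleGraph.irrefl])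
  omega

/-- A vertex of degree three in a graph all of whose degrees are three or four. -/
theorem four_le_excess_of_degreeIn_eq_three (ih : BoundsBelow W) (h3 : TriangleFreeOn G W)
    (hmin : ∀ t ∈ W, 3 ≤ degreeIn G W t) (hmax : ∀ t ∈ W, degreeIn G W t ≤ 4) {v : V}
    (hv : v ∈ W) (hdv : degreeIn G W v = 3) : 4 ≤ excess G W := by
  have two_four : ∀ v ∈ W, ∀ x ∈ W, ∀ y ∈ W, ∀ z ∈ W, x ≠ y → x ≠ z → y ≠ z → G.Adj v x →
      G.Adj v y → G.Adj v z → degreeIn G W v = 3 → degreeIn G W x = 4 → degreeIn G W z = 4 →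
      degreeIn G W y = 3 → 4 ≤ excess G W := by
    intro v hv x hx y hy z hz hxy hxz hyz hvx hvy hvz hdv hdx hdz hdy
    have hnxy := h3 v hv x hx y hy hvx hvy
    have hnyz := h3 v hv y hy z hz hvy hvz
    exact four_le_excess_of_two_adj_degree_four ih h3 hv hx hz hy hxz hvx hvz hdv hdx hdz
      hvy.ne' hxy.symm hyz (by grind [degreeIn_erase, SimpleGraph.adj_comm, SimpleGraph.irrefl])
  have two_three : ∀ x ∈ W, ∀ y ∈ W, ∀ z ∈ W, x ≠ y → x ≠ z → y ≠ z → G.Adj v x →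
      G.Adj v y → G.Adj v z → degreeIn G W y = 3 → degreeIn G W z = 3 → 4 ≤ excess G W := by
    intro x hx y hy z hz hxy hxz hyz hvx hvy hvz hdy hdz
    by_cases hc : ∀ t ∈ W, G.Adj y t → G.Adj z t → t = v
    · have key := ih.delete_suppress h3 hv hx hy hz hxy hxz hyz hvx hvy hvz hdv hc
      have hx3 := hmin x hx
      have hx4 := hmax x hx
      by_cases hdx : degreeIn G W x = 4
      · have := key.1
        omega
      have hdx3 : degreeIn G W x = 3 := by omega
      -- For cubic `x` the balance is only -2. Either another neighbour of `x` has degree 3 and adds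
      -- 8, or `x` has neighbours of degrees 4, 4, 3.
      obtain ⟨s, hs, hxs, hsn⟩ := exists_adj_notMem (G := G) (W := W) (v := x) {v}
        (by rw [card_singleton]; omega)
      obtain ⟨t, ht, hxt, htn⟩ := exists_adj_notMem (G := G) (W := W) (v := x) {v, s}
        (by have := card_le_two (a := v) (b := s); omega)
      simp only [mem_insert, mem_singleton, not_or] at hsn htn
      by_cases hds : degreeIn G W s ≤ 3
      · have := key.2 s hs hxs hsn hds
        omega
      by_cases hdt : degreeIn G W t ≤ 3
      · have := key.2 t ht hxt htn.1 hdt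
        omega
      have hs4 := hmax s hs
      have ht4 := hmax t ht
      exact two_four x hx s hs v hv t ht hsn (Ne.symm htn.2) (Ne.symm htn.1) hxs hvx.symm hxt
        hdx3 (by omega) (by omega) hdv
    · push Not at hc
      obtain ⟨w, hw, hyw, hzw, hwv⟩ := hc
      have hw3 := hmin w hw
      by_cases hdw : degreeIn G W w = 3
      · exact four_le_excess_of_cubic_four_cycle ih h3 hmin hv hw hy hz (Ne.symm hwv) hyz hvy
          hvz hyw.symm hzw.symm hdv hdw hdy hdz
      · exact four_le_excess_of_opposite ih h3 hv hw hy hz (Ne.symm hwv) hyz hvy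
          hvz hyw.symm hzw.symm hdy hdz (by omega)
  obtain ⟨x, hx, hvx, -⟩ := exists_adj_notMem (G := G) (W := W) (v := v) ∅
    (by rw [card_empty]; omega)
  obtain ⟨y, hy, hvy, hyn⟩ := exists_adj_notMem (G := G) (W := W) (v := v) {x}
    (by rw [card_singleton]; omega)
  obtain ⟨z, hz, hvz, hzn⟩ := exists_adj_notMem (G := G) (W := W) (v := v) {x, y}
    (by have := card_le_two (a := x) (b := y); omega)
  simp only [mem_insert, mem_singleton, not_or] at hyn hzn
  have hx3 := hmin x hx
  have hx4 := hmax x hx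
  have hy3 := hmin y hy
  have hy4 := hmax y hy
  have hz3 := hmin z hz
  have hz4 := hmax z hz
  by_cases hall : degreeIn G W x = 4 ∧ degreeIn G W y = 4 ∧ degreeIn G W z = 4
  · obtain ⟨hdx, hdy, hdz⟩ := hall
    by_cases hc : ∀ t ∈ W, G.Adj y t → G.Adj z t → t = v
    · have := (ih.delete_suppress h3 hv hx hy hz (Ne.symm hyn) (Ne.symm hzn.1) (Ne.symm hzn.2)
        hvx hvy hvz hdv hc).1
      omega
    · push Not at hc
      obtain ⟨w, hw, hyw, hzw, hwv⟩ := hc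
      have hw4 := hmax w hw
      -- The common neighbour `w` loses both `y` and `z`, so its degree falls to at most 2.
      exact four_le_excess_of_two_adj_degree_four ih h3 hv hy hz hw (Ne.symm hzn.2) hvy hvz hdv
        hdy hdz hwv hyw.ne' hzw.ne'
          (by grind [degreeIn_erase, SimpleGraph.adj_comm, SimpleGraph.irrefl])
  -- Some neighbour is cubic: if exactly one is, `two_four` applies, otherwise `two_three`.
  · grind

/-! ### Four-regular graphs -/

/-- Two vertices with three common neighbours in a four-regular graph. -/
theorem excess_nonneg_of_three_common (ih : BoundsBelow W) (h3 : TriangleFreeOn G W)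
    (hreg : ∀ t ∈ W, degreeIn G W t = 4) {u v x y z : V} (hu : u ∈ W) (hv : v ∈ W) (hx : x ∈ W)
    (hy : y ∈ W) (hz : z ∈ W) (huv : u ≠ v) (hxy : x ≠ y) (hxz : x ≠ z) (hyz : y ≠ z)
    (hux : G.Adj u x) (huy : G.Adj u y) (huz : G.Adj u z) (hvx : G.Adj v x) (hvy : G.Adj v y)
    (hvz : G.Adj v z) : 0 ≤ excess G W := by
  have hnxy := h3 v hv x hx y hy hvx hvy
  have hnyz := h3 v hv y hy z hz hvy hvz
  have hnxz := h3 v hv x hx z hz hvx hvz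
  have hnuv := h3 x hx u hu v hv hux.symm hvx.symm
  have hdu := hreg u hu
  have hdv := hreg v hv
  have hdx := hreg x hx
  have hdy := hreg y hy
  have hdz := hreg z hz
  clear hreg
  -- Balance: -30 + 18 + 18 = 6.
  have e1 := excess_delete (G := G) hx
  have e2 := excess_delete (G := G) (W := W.erase x) (v := y)
    (by grind [SimpleGraph.adj_comm, SimpleGraph.irrefl])
  have e3 := excess_delete (G := G) (W := (W.erase x).erase y) (v := z)
    (by grind [SimpleGraph.adj_comm, SimpleGraph.irrefl])
  have e4 := excess_pendant (G := G) (W := ((W.erase x).erase y).erase z) (v := u)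
    (by grind [SimpleGraph.adj_comm, SimpleGraph.irrefl])
    (by grind [degreeIn_erase, SimpleGraph.adj_comm, SimpleGraph.irrefl])
  have e5 := excess_pendant (G := G) (W := (((W.erase x).erase y).erase z).erase u) (v := v)
    (by grind [SimpleGraph.adj_comm, SimpleGraph.irrefl])
    (by grind [degreeIn_erase, SimpleGraph.adj_comm, SimpleGraph.irrefl])
  have e6 := (ih.of_subset_erase h3 hx
    (W' := ((((W.erase x).erase y).erase z).erase u).erase v)
    (by grind [SimpleGraph.adj_comm, SimpleGraph.irrefl])).1
  grind [degreeIn_erase, SimpleGraph.adj_comm, SimpleGraph.irrefl]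

/-- Two vertices with exactly two common neighbours in a four-regular graph. -/
theorem excess_nonneg_of_two_common (ih : BoundsBelow W) (h3 : TriangleFreeOn G W)
    (hreg : ∀ t ∈ W, degreeIn G W t = 4) {u v x y p q r : V} (hu : u ∈ W) (hv : v ∈ W)
    (hx : x ∈ W) (hy : y ∈ W) (hp : p ∈ W) (hq : q ∈ W) (hr : r ∈ W) (huv : u ≠ v)
    (hxy : x ≠ y) (hpx : p ≠ x) (hpy : p ≠ y) (hqx : q ≠ x) (hqy : q ≠ y) (hpq : p ≠ q)
    (hrx : r ≠ x) (hry : r ≠ y) (hux : G.Adj u x) (huy : G.Adj u y)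
    (hvx : G.Adj v x) (hvy : G.Adj v y) (hvp : G.Adj v p) (hvq : G.Adj v q) (hur : G.Adj u r)
    (hnup : ¬ G.Adj u p) (hnvr : ¬ G.Adj v r)
    (hnpr : ¬ G.Adj p r) : 0 ≤ excess G W := by
  have hnxy := h3 v hv x hx y hy hvx hvy
  have hnxp := h3 v hv x hx p hp hvx hvp
  have hnyp := h3 v hv y hy p hp hvy hvp
  have hnxr := h3 u hu x hx r hr hux hur
  have hnyr := h3 u hu y hy r hr huy hur
  have hnuv := h3 x hx u hu v hv hux.symm hvx.symm
  have hdu := hreg u hu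
  have hdv := hreg v hv
  have hdx := hreg x hx
  have hdy := hreg y hy
  have hdp := hreg p hp
  have hdq := hreg q hq
  have hdr := hreg r hr
  clear hreg
  -- Balance: -30 + 18 - 10 + 18 + 4 = 0, where `q` has lost `v` and supplies the 4.
  have e1 := excess_delete (G := G) hx
  have e2 := excess_delete (G := G) (W := W.erase x) (v := y)
    (by grind [SimpleGraph.adj_comm, SimpleGraph.irrefl])
  have e3 := excess_delete (G := G) (W := (W.erase x).erase y) (v := p)
    (by grind [SimpleGraph.adj_comm, SimpleGraph.irrefl])
  have e4 := excess_pendant (G := G) (W := ((W.erase x).erase y).erase p) (v := v)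
    (by grind [SimpleGraph.adj_comm, SimpleGraph.irrefl])
    (by grind [degreeIn_erase, SimpleGraph.adj_comm, SimpleGraph.irrefl])
  have e5 := excess_delete (G := G) (W := (((W.erase x).erase y).erase p).erase v) (v := r)
    (by grind [SimpleGraph.adj_comm, SimpleGraph.irrefl])
  have e6 := excess_pendant (G := G) (W := ((((W.erase x).erase y).erase p).erase v).erase r)
    (v := u) (by grind [SimpleGraph.adj_comm, SimpleGraph.irrefl])
    (by grind [degreeIn_erase, SimpleGraph.adj_comm, SimpleGraph.irrefl])
  have hsub : (((((W.erase x).erase y).erase p).erase v).erase r).erase u ⊆ W.erase v := by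
    intro s hs
    simp only [mem_erase] at hs ⊢
    exact ⟨hs.2.2.1, hs.2.2.2.2.2.2⟩
  have e7 := (ih.of_subset_erase h3 hv hsub).2.1 q
    (by grind [SimpleGraph.adj_comm, SimpleGraph.irrefl])
    ((degreeIn_mono hsub q).trans
    (by grind [degreeIn_erase, SimpleGraph.adj_comm, SimpleGraph.irrefl]))
  grind [degreeIn_erase, SimpleGraph.adj_comm, SimpleGraph.irrefl]

/-- A vertex of a four-regular graph two of whose neighbours have no other common neighbour. -/
theorem excess_nonneg_of_no_four_cycle (ih : BoundsBelow W) (h3 : TriangleFreeOn G W)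
    (hreg : ∀ t ∈ W, degreeIn G W t = 4) {v a b c d t : V} (hv : v ∈ W) (ha : a ∈ W) (hb : b ∈ W)
    (hc : c ∈ W) (hd : d ∈ W) (ht : t ∈ W) (hab : a ≠ b) (hca : c ≠ a) (hcb : c ≠ b)
    (hda : d ≠ a) (hdb : d ≠ b) (hcd : c ≠ d) (hva : G.Adj v a) (hvb : G.Adj v b)
    (hvc : G.Adj v c) (hvd : G.Adj v d) (hat : G.Adj a t) (htv : t ≠ v)
    (hno : ∀ s ∈ W, G.Adj c s → G.Adj d s → s = v) : 0 ≤ excess G W := by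
  have hnab := h3 v hv a ha b hb hva hvb
  have hnac := h3 v hv a ha c hc hva hvc
  have hnad := h3 v hv a ha d hd hva hvd
  have hnvt := h3 a ha v hv t ht hva.symm hat
  have hdv := hreg v hv
  have hda4 := hreg a ha
  have hdb4 := hreg b hb
  have hdt4 := hreg t ht
  clear hreg
  -- Balance: -20 + 22 = 2, as `t` has lost `a`.
  have e1 := excess_delete (G := G) ha
  have e2 := excess_delete (G := G) (W := W.erase a) (v := b)
    (by grind [SimpleGraph.adj_comm, SimpleGraph.irrefl])
  have hsub : (W.erase a).erase b ⊆ W := by grind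
  have e3 := (ih.suppress hsub (h3.mono hsub) (v := v) (y := c) (z := d)
    (by grind [SimpleGraph.adj_comm, SimpleGraph.irrefl])
    (by grind [SimpleGraph.adj_comm, SimpleGraph.irrefl])
    (by grind [SimpleGraph.adj_comm, SimpleGraph.irrefl]) hcd hvc hvd
    (by grind [degreeIn_erase, SimpleGraph.adj_comm, SimpleGraph.irrefl])
    (fun s hs => hno s (hsub hs))).2.1 t
    (by grind [SimpleGraph.adj_comm, SimpleGraph.irrefl]) htv
    (by grind [SimpleGraph.adj_comm, SimpleGraph.irrefl])
    (by grind [SimpleGraph.adj_comm, SimpleGraph.irrefl])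
    (by grind [SimpleGraph.adj_comm, SimpleGraph.irrefl])
    (by grind [degreeIn_erase, SimpleGraph.adj_comm, SimpleGraph.irrefl])
  grind [degreeIn_erase, SimpleGraph.adj_comm, SimpleGraph.irrefl]

theorem excess_nonneg_of_four_regular (ih : BoundsBelow W) (h3 : TriangleFreeOn G W)
    (hreg : ∀ t ∈ W, degreeIn G W t = 4) {v : V} (hv : v ∈ W) : 0 ≤ excess G W := by
  by_cases hthree : ∃ u ∈ W, ∃ v ∈ W, ∃ x ∈ W, ∃ y ∈ W, ∃ z ∈ W, u ≠ v ∧ x ≠ y ∧ x ≠ z ∧ y ≠ z ∧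
      G.Adj u x ∧ G.Adj u y ∧ G.Adj u z ∧ G.Adj v x ∧ G.Adj v y ∧ G.Adj v z
  · obtain ⟨u, hu, v, hv, x, hx, y, hy, z, hz, h1, h2, h4, h5, h6, h7, h8, h9, h10, h11⟩ := hthree
    exact excess_nonneg_of_three_common ih h3 hreg hu hv hx hy hz h1 h2 h4 h5 h6 h7 h8 h9 h10 h11
  have two_more : ∀ v ∈ W, ∀ x y, ∃ p ∈ W, ∃ q ∈ W, G.Adj v p ∧ G.Adj v q ∧ p ≠ x ∧ p ≠ y ∧
      q ≠ x ∧ q ≠ y ∧ p ≠ q := by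
    intro v hv x y
    have hdv := hreg v hv
    obtain ⟨p, hp, hvp, hpn⟩ := exists_adj_notMem (G := G) (W := W) (v := v) {x, y}
      (by have := card_le_two (a := x) (b := y); omega)
    obtain ⟨q, hq, hvq, hqn⟩ := exists_adj_notMem (G := G) (W := W) (v := v) {x, y, p}
      (by have := card_le_three (a := x) (b := y) (c := p); omega)
    simp only [mem_insert, mem_singleton, not_or] at hpn hqn
    exact ⟨p, hp, q, hq, hvp, hvq, hpn.1, hpn.2, hqn.1, hqn.2.1, Ne.symm hqn.2.2⟩
  by_cases htwo : ∃ u ∈ W, ∃ v ∈ W, ∃ x ∈ W, ∃ y ∈ W, u ≠ v ∧ x ≠ y ∧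
      G.Adj u x ∧ G.Adj u y ∧ G.Adj v x ∧ G.Adj v y
  · obtain ⟨u, hu, v, hv, x, hx, y, hy, huv, hxy, hux, huy, hvx, hvy⟩ := htwo
    obtain ⟨p, hp, q, hq, hvp, hvq, hpx, hpy, hqx, hqy, hpq⟩ := two_more v hv x y
    obtain ⟨r, hr, s, hs, hur, hus, hrx, hry, hsx, hsy, hrs⟩ := two_more u hu x y
    push Not at hthree
    have hnup : ¬ G.Adj u p := fun h =>
      hthree u hu v hv x hx y hy p hp huv hxy hpx.symm hpy.symm hux huy h hvx hvy hvp
    have hnuq : ¬ G.Adj u q := fun h =>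
      hthree u hu v hv x hx y hy q hq huv hxy hqx.symm hqy.symm hux huy h hvx hvy hvq
    have hnvr : ¬ G.Adj v r := fun h =>
      hthree u hu v hv x hx y hy r hr huv hxy hrx.symm hry.symm hux huy hur hvx hvy h
    have hnvs : ¬ G.Adj v s := fun h =>
      hthree u hu v hv x hx y hy s hs huv hxy hsx.symm hsy.symm hux huy hus hvx hvy h
    by_cases hpr : G.Adj p r
    swap
    · exact excess_nonneg_of_two_common ih h3 hreg hu hv hx hy hp hq hr huv hxy hpx hpy hqx hqy
        hpq hrx hry hux huy hvx hvy hvp hvq hur hnup hnvr hpr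
    by_cases hps : G.Adj p s
    swap
    · exact excess_nonneg_of_two_common ih h3 hreg hu hv hx hy hp hq hs huv hxy hpx hpy hqx hqy
        hpq hsx hsy hux huy hvx hvy hvp hvq hus hnup hnvs hps
    by_cases hqr : G.Adj q r
    swap
    · exact excess_nonneg_of_two_common ih h3 hreg hu hv hx hy hq hp hr huv hxy hqx hqy hpx hpy
        hpq.symm hrx hry hux huy hvx hvy hvq hvp hur hnuq hnvr hqr
    by_cases hqs : G.Adj q s
    swap
    · exact excess_nonneg_of_two_common ih h3 hreg hu hv hx hy hq hp hs huv hxy hqx hqy hpx hpy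
        hpq.symm hsx hsy hux huy hvx hvy hvq hvp hus hnuq hnvs hqs
    -- Now `p` and `q` share the three neighbours `v`, `r`, `s`.
    have hvr : v ≠ r := fun h => h3 x hx v hv u hu hvx.symm hux.symm (h ▸ hur.symm)
    have hvs : v ≠ s := fun h => h3 x hx v hv u hu hvx.symm hux.symm (h ▸ hus.symm)
    exact absurd hqs (hthree p hp q hq v hv r hr s hs hpq hvr hvs hrs hvp.symm hpr hps
      hvq.symm hqr)
  obtain ⟨a, ha, b, hb, hva, hvb, -, -, -, -, hab⟩ := two_more v hv v v
  obtain ⟨c, hc, d, hd, hvc, hvd, hca, hcb, hda, hdb, hcd⟩ := two_more v hv a b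
  obtain ⟨t, ht, hat, htv⟩ := exists_adj_notMem (G := G) (W := W) (v := a) {v}
    (by rw [card_singleton, hreg a ha]; omega)
  rw [mem_singleton] at htv
  exact excess_nonneg_of_no_four_cycle ih h3 hreg hv ha hb hc hd ht hab hca hcb hda hdb hcd hva hvb
    hvc hvd hat htv fun s hs h1 h2 => by
      by_contra hsv
      exact htwo ⟨c, hc, d, hd, v, hv, s, hs, hcd, Ne.symm hsv, hvc.symm, h1, hvd.symm, h2⟩

/-! ### The induction and the conclusion -/

theorem excessBounds : ∀ (W : Finset V) (G : SimpleGraph V), TriangleFreeOn G W →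
    ExcessBounds G W := by
  intro W
  induction W using Finset.strongInduction with
  | H W ih' =>
  intro G h3
  have ih : BoundsBelow W := fun G' W' hW' h3' => ih' W' hW' G' h3'
  by_cases hbig : ∃ a ∈ W, 5 ≤ degreeIn G W a
  · obtain ⟨a, ha, hda⟩ := hbig
    -- Since 10 · 5 - 50 = 0, this deletion costs nothing, and no other degree rises, so the bonuses
    -- survive.
    have e1 := excess_delete (G := G) ha
    have e2 := ih.of_subset_erase h3 ha subset_rfl
    refine ⟨by linarith [e2.1], fun u hu hdu => ?_, fun u hu hdu => ?_⟩
    · have := e2.2.1 u (mem_erase.2 ⟨by grind, hu⟩) ((degreeIn_erase_le a u).trans hdu)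
      omega
    · have := e2.2.2 u (mem_erase.2 ⟨by grind, hu⟩) ((degreeIn_erase_le a u).trans hdu)
      omega
  have hmax : ∀ t ∈ W, degreeIn G W t ≤ 4 := fun t ht => by
    by_contra h
    exact hbig ⟨t, ht, by omega⟩
  have h2 : ∀ u ∈ W, degreeIn G W u ≤ 2 → 8 ≤ excess G W := fun u hu hdu =>
    eight_le_excess_of_degreeIn_le_two ih h3 hmax hu hdu
  have h4 : ∀ u ∈ W, degreeIn G W u ≤ 3 → 4 ≤ excess G W := fun u hu hdu => by
    by_cases hmin : ∀ t ∈ W, 3 ≤ degreeIn G W t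
    · exact four_le_excess_of_degreeIn_eq_three ih h3 hmin hmax hu (le_antisymm hdu (hmin u hu))
    · push Not at hmin
      obtain ⟨t, ht, hdt⟩ := hmin
      linarith [h2 t ht (by omega)]
  refine ⟨?_, h4, h2⟩
  by_cases hlow : ∃ t ∈ W, degreeIn G W t ≤ 3
  · obtain ⟨t, ht, hdt⟩ := hlow
    linarith [h4 t ht hdt]
  obtain rfl | ⟨v, hv⟩ := W.eq_empty_or_nonempty
  · simp [excess]
  · refine excess_nonneg_of_four_regular ih h3 (fun t ht => le_antisymm (hmax t ht) ?_) hv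
    by_contra h
    exact hlow ⟨t, ht, by omega⟩

end

end InducedForest

theorem theoremC1 {V : Type*} [Fintype V] (G : SimpleGraph V) [DecidableRel G.Adj]
    (htri : G.CliqueFree 3) (havg : InducedForest.averageDegree G ≤ 4) :
    15 * (Fintype.card V : ℚ) / 29 ≤ (InducedForest.forestNumber G : ℚ) := by
  classical
  have h3 : InducedForest.TriangleFreeOn G Finset.univ := fun a _ b _ c _ hab hac hbc =>
    htri {a, b, c} (SimpleGraph.is3Clique_triple_iff.2 ⟨hab, hac, hbc⟩)
  have h0 := (InducedForest.excessBounds Finset.univ G h3).1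
  obtain ⟨S, -, hS, hcard⟩ := InducedForest.exists_forestCard G Finset.univ
  have hle : InducedForest.forestCard G Finset.univ ≤ InducedForest.forestNumber G :=
    (InducedForest.forestNumber_isGreatest G).2 ⟨S, hS.isAcyclicSet, hcard⟩
  have hdeg : ∀ v, InducedForest.degreeIn G Finset.univ v = G.degree v := fun v => by
    rw [InducedForest.degreeIn, ← SimpleGraph.card_neighborFinset_eq_degree]
    congr 1
    ext u
    simp [InducedForest.mem_neighborsIn]
  have hsum : ∑ v : V, (G.degree v : ℚ) ≤ 4 * Fintype.card V := by
    -- With no vertices the average is 0/0 = 0 and carries no information; both sides vanish.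
    rcases Nat.eq_zero_or_pos (Fintype.card V) with h | h
    · have := Fintype.card_eq_zero_iff.1 h
      simp
    · rw [InducedForest.averageDegree, div_le_iff₀ (by exact_mod_cast h)] at havg
      exact havg
  rw [InducedForest.excess] at h0
  simp only [hdeg, Finset.card_univ] at h0
  have h0' : (0 : ℚ) ≤ 58 * InducedForest.forestCard G Finset.univ - 50 * Fintype.card V +
      5 * ∑ v : V, (G.degree v : ℚ) := by exact_mod_cast h0
  have hle' : (InducedForest.forestCard G Finset.univ : ℚ) ≤ InducedForest.forestNumber G := by
    exact_mod_cast hle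
  -- The bounds give 58a ≥ 50n - 20n.
  rw [div_le_iff₀ (by norm_num)]
  linarith
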